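/- Let $0<p,q\le\infty$. For $0<p<\infty$ the Fock space $\mathcal F_p$ consists of the entire functions $f$ with $\|f\|_p^p=\frac{p}{2\pi}\int_{\mathbb C}|f(z)|^p e^{-\frac p2|z|^2}\,dA(z)<\infty$, where $dA$ is Lebesgue area measure, and $\mathcal F_\infty$ consists of the entire functions $f$ with $\|f\|_\infty=\sup_{z\in\mathbb C}|f(z)|e^{-\frac12|z|^2}<\infty$. For an entire function $g$ let $V_gf(z)=\int_0^z f(w)g'(w)\,dw$. Let $\mathbf V(\mathcal F_p,\mathcal F_q)$ be the space of all bounded operators $V_g:\mathcal F_p\to\mathcal F_q$ with $g$ entire, with the topology of the operator (quasi-)norm $\|T\|=\sup_{\|f\|_p\le1}\|Tf\|_q$. Let $g$ be entire and let $V_g:\mathcal F_p\to\mathcal F_q$ be a compact operator. Then $V_g$ and $V_{g(0)}$, the latter being the zero operator, belong to the same path connected component of $\mathbf V(\mathcal F_p,\mathcal F_q)$. More precisely, $g$ is affine, that is, $g(z)=az+b$ for some $a,b\in\mathbb C$, and with $g_t(z)=g(tz)$ the map $t\mapsto V_{g_t}$, $0\le t\le1$, is a continuous path in $\mathbf V(\mathcal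 F_p,\mathcal F_q)$ from $V_{g(0)}$ to $V_g$. -/

import Mathlib

open scoped ENNReal

noncomputable section

/-- The Fock (quasi-)norm of a function `f : ℂ → ℂ`, with values in `[0, ∞]`: for `0 < p < ∞` it is
`(p / 2π ∫ |f z| ^ p e ^ (-p |z|² / 2) dA(z)) ^ (1 / p)`, and for `p = ∞` it is
`sup |f z| e ^ (-|z|² / 2)`. The exponent `p = 0` is not used. -/
def fockNorm (p : ℝ≥0∞) (f : ℂ → ℂ) : ℝ≥0∞ :=
  if p = ∞ then ⨆ z : ℂ, ‖f z‖ₑ * ENNReal.ofReal (Real.exp (-(‖z‖ ^ 2 / 2)))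
  else (ENNReal.ofReal (p.toReal / (2 * Real.pi)) *
    ∫⁻ z : ℂ, ‖f z‖ₑ ^ p.toReal * ENNReal.ofReal (Real.exp (-(p.toReal / 2 * ‖z‖ ^ 2)))) ^
      (1 / p.toReal)

theorem fockNorm_lt_top_iff {p : ℝ≥0∞} (hp : p ≠ ∞) (hp0 : p ≠ 0) (f : ℂ → ℂ) :
    fockNorm p f < ∞ ↔
      ∫⁻ z : ℂ, ‖f z‖ₑ ^ p.toReal *
        ENNReal.ofReal (Real.exp (-(p.toReal / 2 * ‖z‖ ^ 2))) < ∞ := by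
  have hpos : 0 < p.toReal := ENNReal.toReal_pos hp0 hp
  have hc : ENNReal.ofReal (p.toReal / (2 * Real.pi)) ≠ 0 := by
    rw [Ne, ENNReal.ofReal_eq_zero, not_le]
    positivity
  rw [fockNorm, if_neg hp, ENNReal.rpow_lt_top_iff_of_pos (by positivity)]
  constructor
  · intro h
    exact ENNReal.lt_top_of_mul_ne_top_right h.ne hc
  · intro h
    exact ENNReal.mul_lt_top ENNReal.ofReal_lt_top h

theorem fockNorm_exponent_zero (f : ℂ → ℂ) : fockNorm 0 f < ∞ := by
  simp [fockNorm]

/-- The Fock space `F_p` as a linear subspace of the functions `ℂ → ℂ`: the entire functions of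
finite Fock norm. -/
def fockSubmodule (p : ℝ≥0∞) : Submodule ℂ (ℂ → ℂ) where
  carrier := {f | Differentiable ℂ f ∧ fockNorm p f < ∞}
  zero_mem' := by
    refine ⟨differentiable_const 0, ?_⟩
    rcases eq_or_ne p 0 with rfl | hp0
    · exact fockNorm_exponent_zero _
    rcases eq_or_ne p ∞ with rfl | hp
    · simp [fockNorm]
    · rw [fockNorm_lt_top_iff hp hp0]
      simp [ENNReal.toReal_pos hp0 hp]
  add_mem' := by
    rintro f g ⟨hf, hf'⟩ ⟨hg, hg'⟩
    refine ⟨hf.add hg, ?_⟩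
    rcases eq_or_ne p 0 with rfl | hp0
    · exact fockNorm_exponent_zero _
    rcases eq_or_ne p ∞ with rfl | hp
    · refine lt_of_le_of_lt ?_ (ENNReal.add_lt_top.2 ⟨hf', hg'⟩)
      simp only [fockNorm, if_true]
      refine iSup_le fun z => ?_
      refine le_trans ?_ (add_le_add
        (le_iSup (fun z : ℂ => ‖f z‖ₑ * ENNReal.ofReal (Real.exp (-(‖z‖ ^ 2 / 2)))) z)
        (le_iSup (fun z : ℂ => ‖g z‖ₑ * ENNReal.ofReal (Real.exp (-(‖z‖ ^ 2 / 2)))) z))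
      rw [← add_mul]
      gcongr
      exact enorm_add_le _ _
    · rw [fockNorm_lt_top_iff hp hp0] at hf' hg' ⊢
      have hpos : 0 < p.toReal := ENNReal.toReal_pos hp0 hp
      have hmeas : Measurable fun z : ℂ =>
          ‖f z‖ₑ ^ p.toReal * ENNReal.ofReal (Real.exp (-(p.toReal / 2 * ‖z‖ ^ 2))) := by
        have := hf.continuous.measurable
        fun_prop
      refine lt_of_le_of_lt ?_ (ENNReal.mul_lt_top
        (ENNReal.rpow_lt_top_of_nonneg hpos.le (ENNReal.ofNat_ne_top (n := 2)))
        (ENNReal.add_lt_top.2 ⟨hf', hg'⟩))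
      rw [← MeasureTheory.lintegral_add_left hmeas,
        ← MeasureTheory.lintegral_const_mul' _ _
          (ENNReal.rpow_lt_top_of_nonneg hpos.le (ENNReal.ofNat_ne_top (n := 2))).ne]
      refine MeasureTheory.lintegral_mono fun z => ?_
      rw [← add_mul, ← mul_assoc]
      gcongr
      have h1 : ‖(f + g) z‖ₑ ≤ 2 * max ‖f z‖ₑ ‖g z‖ₑ := by
        refine (enorm_add_le _ _).trans ?_
        rw [two_mul]
        exact add_le_add (le_max_left _ _) (le_max_right _ _)
      refine (ENNReal.rpow_le_rpow h1 hpos.le).trans ?_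
      rw [ENNReal.mul_rpow_of_nonneg _ _ hpos.le]
      gcongr
      rcases max_choice ‖f z‖ₑ ‖g z‖ₑ with h | h <;> rw [h]
      · exact le_self_add
      · exact le_add_self
  smul_mem' := by
    rintro c f ⟨hf, hf'⟩
    refine ⟨hf.const_smul c, ?_⟩
    rcases eq_or_ne p 0 with rfl | hp0
    · exact fockNorm_exponent_zero _
    rcases eq_or_ne p ∞ with rfl | hp
    · refine lt_of_le_of_lt ?_ (ENNReal.mul_lt_top (enorm_lt_top (x := c)) hf')
      simp only [fockNorm, if_true, ENNReal.mul_iSup]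
      refine iSup_mono fun z => ?_
      rw [Pi.smul_apply, enorm_smul, mul_assoc]
    · rw [fockNorm_lt_top_iff hp hp0] at hf' ⊢
      have hpos : 0 < p.toReal := ENNReal.toReal_pos hp0 hp
      have hc : ‖c‖ₑ ^ p.toReal < ∞ := ENNReal.rpow_lt_top_of_nonneg hpos.le enorm_ne_top
      refine lt_of_le_of_lt ?_ (ENNReal.mul_lt_top hc hf')
      rw [← MeasureTheory.lintegral_const_mul' _ _ hc.ne]
      refine MeasureTheory.lintegral_mono fun z => ?_
      rw [Pi.smul_apply, enorm_smul, ENNReal.mul_rpow_of_nonneg _ _ hpos.le, mul_assoc]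

/-- The Fock space `F_p` as a type of its own, so that it does not inherit the topology of
pointwise convergence from `ℂ → ℂ`. -/
def FockSpace (p : ℝ≥0∞) : Type := fockSubmodule p

instance (p : ℝ≥0∞) : AddCommGroup (FockSpace p) :=
  inferInstanceAs (AddCommGroup (fockSubmodule p))

instance (p : ℝ≥0∞) : Module ℂ (FockSpace p) :=
  inferInstanceAs (Module ℂ (fockSubmodule p))

/-- The entire function underlying an element of the Fock space. -/
def FockSpace.toFun {p : ℝ≥0∞} (f : FockSpace p) : ℂ → ℂ := f.1

instance (p : ℝ≥0∞) : CoeFun (FockSpace p) (fun _ => ℂ → ℂ) := ⟨FockSpace.toFun⟩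

/-- The topology in which a set is open if and only if with each of its points it contains a ball
of positive radius around it. For the distance of a norm or a quasi-norm this is the usual
topology, and the balls around a point form a basis of its neighbourhoods. -/
@[reducible]
def topologyOfDist {X : Type*} (d : X → X → ℝ≥0∞) : TopologicalSpace X where
  IsOpen U := ∀ x ∈ U, ∃ ε > 0, ∀ y, d y x < ε → y ∈ U
  isOpen_univ := fun _ _ => ⟨1, one_pos, fun _ _ => trivial⟩
  isOpen_inter := by
    rintro s t hs ht x ⟨hxs, hxt⟩
    obtain ⟨ε, hε, h⟩ := hs x hxs
    obtain ⟨δ, hδ, h'⟩ := ht x hxt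
    exact ⟨min ε δ, lt_min hε hδ, fun y hy =>
      ⟨h y (hy.trans_le (min_le_left _ _)), h' y (hy.trans_le (min_le_right _ _))⟩⟩
  isOpen_sUnion := by
    rintro S hS x ⟨U, hU, hx⟩
    obtain ⟨ε, hε, h⟩ := hS U hU x hx
    exact ⟨ε, hε, fun y hy => ⟨U, hU, h y hy⟩⟩

/-- The topology of `F_p` given by its (quasi-)norm. -/
instance (p : ℝ≥0∞) : TopologicalSpace (FockSpace p) :=
  topologyOfDist fun f h => fockNorm p (f - h : FockSpace p)

/-- The operator (quasi-)norm `sup {‖T f‖_q : ‖f‖_p ≤ 1}` of a linear map `T : F_p → F_q`. -/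
def fockOpNorm {p q : ℝ≥0∞} (T : FockSpace p →ₗ[ℂ] FockSpace q) : ℝ≥0∞ :=
  ⨆ (f : FockSpace p) (_ : fockNorm p f ≤ 1), fockNorm q (T f)

/-- The Volterra-type integral `V_g f (z) = ∫_0^z f(w) g'(w) dw`, taken along the segment
`w = t z`, `0 ≤ t ≤ 1`. -/
def volterra (g f : ℂ → ℂ) (z : ℂ) : ℂ :=
  z * ∫ t in (0 : ℝ)..1, f (t * z) * deriv g (t * z)

/-- `T : F_p → F_q` is the Volterra-type integral operator `V_g`; in particular `V_g` maps `F_p`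
into `F_q`. -/
def IsVolterraOp {p q : ℝ≥0∞} (g : ℂ → ℂ) (T : FockSpace p →ₗ[ℂ] FockSpace q) : Prop :=
  ∀ (f : FockSpace p) (z : ℂ), T f z = volterra g f z

/-- The space `V(F_p, F_q)` of all bounded Volterra-type integral operators `V_g : F_p → F_q`,
where `g` is entire. -/
structure VolterraSpace (p q : ℝ≥0∞) where
  /-- The operator. -/
  op : FockSpace p →ₗ[ℂ] FockSpace q
  bounded : fockOpNorm op < ∞
  exists_symbol : ∃ g : ℂ → ℂ, Differentiable ℂ g ∧ IsVolterraOp g op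

/-- The operator norm topology of `V(F_p, F_q)`. -/
instance (p q : ℝ≥0∞) : TopologicalSpace (VolterraSpace p q) :=
  topologyOfDist fun S T => fockOpNorm (S.op - T.op)

end

/-!
The heart of the matter is that a compact `V_g` has an affine symbol. The normalized reproducing
kernels `k_w z = exp (conj w * z - |w|² / 2)` have bounded norm in every Fock space, since
`|k_w z| * exp (-|z|² / 2)` is a translate of one Gaussian, and `V_g k_w → 0` pointwise as `w → ∞`.
A compact operator turns this into `‖V_g k_w‖_q → 0` (`tendsto_fockNorm_of_isCompactOperator`):
the images lie in a compact set, and as point evaluations are continuous their only cluster point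
is `0`. On the other hand `(V_g k_w)' w = k_w w * g' w = exp (|w|² / 2) * g' w`, while every `F` in
`F_q` satisfies `|F' w| ≤ C * (1 + |w|) * exp (|w|² / 2) * ‖F‖_q`
(`exists_norm_deriv_le_fockNorm`). Hence `g' w = o(|w|)`, and by Cauchy's estimate `g'` is constant.

When `g` is affine, the operator with symbol `z ↦ g (t * z)` is `t • V_g`. A compact operator is
bounded (`fockOpNorm_lt_top_of_isCompactOperator`), so the path is the segment from `0` to `V_g`,
and its continuity is the homogeneity of the operator quasi-norm.

The pointwise estimates have to hold for all exponents `0 < q ≤ ∞`. They rest on a mean value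
inequality for `|F| ^ q` with an unspecified constant (`exists_enorm_rpow_le`), which is obtained
from the area mean value property by a maximum argument and does not use that `|F| ^ q` is
subharmonic. For `q < 1` the balls of the quasi-norm are still open
(`FockSpace.isOpen_fockNorm_lt`), because the `q`-th power of the quasi-norm is subadditive.
-/

open MeasureTheory Metric Filter Topology

/-! ### The mean value inequality for powers of an entire function -/

theorem two_pi_mul_enorm_le_lintegral_circleMap {F : ℂ → ℂ} (hF : Differentiable ℂ F) (z : ℂ)
    (ρ : ℝ) :
    ENNReal.ofReal (2 * Real.pi) * ‖F z‖ₑ ≤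
      ∫⁻ θ in Set.Ioo (-Real.pi) Real.pi, ‖F (circleMap z ρ θ)‖ₑ := by
  have h1 : Real.circleAverage F z ρ = F z := hF.diffContOnCl.circleAverage
  rw [Real.circleAverage_def] at h1
  have h2 : ∫ θ in (0 : ℝ)..2 * Real.pi, F (circleMap z ρ θ) =
      ∫ θ in (-Real.pi)..Real.pi, F (circleMap z ρ θ) := by
    have hper : Function.Periodic (fun θ => F (circleMap z ρ θ)) (2 * Real.pi) := fun θ => by
      simp only [periodic_circleMap z ρ θ]
    have := hper.intervalIntegral_add_eq 0 (-Real.pi)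
    rwa [zero_add, show -Real.pi + 2 * Real.pi = Real.pi by ring] at this
  have h3 : (2 * Real.pi) • F z = ∫ θ in Set.Ioo (-Real.pi) Real.pi, F (circleMap z ρ θ) := by
    rw [← h1, h2, smul_smul, mul_inv_cancel₀ (by positivity), one_smul,
      intervalIntegral.integral_of_le (by linarith [Real.pi_pos]), integral_Ioc_eq_integral_Ioo]
  have h4 : ENNReal.ofReal (2 * Real.pi) * ‖F z‖ₑ = ‖(2 * Real.pi) • F z‖ₑ := by
    rw [enorm_smul, Real.enorm_of_nonneg (by positivity)]
  rw [h4, h3]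
  exact enorm_integral_le_lintegral_enorm _

/-- The area mean value inequality. Both sides are written in polar coordinates, which reduces the
claim to the mean value property on each circle. -/
theorem volume_ball_mul_enorm_le {F : ℂ → ℂ} (hF : Differentiable ℂ F) (z : ℂ) (r : ℝ) :
    volume (ball z r) * ‖F z‖ₑ ≤ ∫⁻ ζ in ball z r, ‖F ζ‖ₑ := by
  have polar : ∀ u : ℂ → ℝ≥0∞, Measurable u → ∫⁻ ζ in ball z r, u ζ =
      ∫⁻ ρ in Set.Ioi (0 : ℝ), ∫⁻ θ in Set.Ioo (-Real.pi) Real.pi,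
        (Set.Iio r).indicator (fun ρ => ENNReal.ofReal ρ) ρ * u (circleMap z ρ θ) := by
    intro u hu
    have hm : Measurable ((ball z r).indicator u) := hu.indicator measurableSet_ball
    rw [← lintegral_indicator measurableSet_ball,
      ← lintegral_add_left_eq_self _ z,
      ← Complex.lintegral_comp_polarCoord_symm, polarCoord_target,
      Measure.volume_eq_prod, ← Measure.prod_restrict]
    have hsymm : ∀ p : ℝ × ℝ, z + Complex.polarCoord.symm p = circleMap z p.1 p.2 := by
      intro p
      rw [Complex.polarCoord_symm_apply, circleMap, Complex.exp_mul_I, Complex.ofReal_cos,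
        Complex.ofReal_sin]
    simp only [hsymm]
    have hm' : Measurable fun p : ℝ × ℝ =>
        ENNReal.ofReal p.1 • (ball z r).indicator u (circleMap z p.1 p.2) := by
      refine (ENNReal.measurable_ofReal.comp measurable_fst).smul (hm.comp ?_)
      unfold circleMap
      fun_prop
    rw [lintegral_prod _ hm'.aemeasurable]
    refine setLIntegral_congr_fun measurableSet_Ioi fun ρ hρ => ?_
    refine lintegral_congr fun θ => ?_
    have hρ' : |ρ| = ρ := abs_of_pos hρ
    by_cases h : ρ < r
    · simp [Set.indicator, h, dist_eq_norm, hρ']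
    · simp [Set.indicator, h, dist_eq_norm, hρ']
  have h1 := polar (fun _ => 1) measurable_const
  simp only [lintegral_const, Measure.restrict_apply, MeasurableSet.univ, Set.univ_inter, one_mul,
    Real.volume_Ioo, mul_one] at h1
  rw [h1, polar _ hF.continuous.enorm.measurable, ← lintegral_mul_const' _ _ enorm_ne_top]
  refine lintegral_mono fun ρ => ?_
  simp only
  have hm : Measurable fun θ => ‖F (circleMap z ρ θ)‖ₑ :=
    (hF.continuous.comp (continuous_circleMap z ρ)).enorm.measurable
  rw [lintegral_const_mul _ hm, mul_assoc]
  gcongr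
  rw [show Real.pi - -Real.pi = 2 * Real.pi by ring]
  exact two_pi_mul_enorm_le_lintegral_circleMap hF z ρ

/-- For `0 < s ≤ 1` the mean value inequality for `|F| ^ s`, up to a constant. At a point `z₀` where
`(1 - |z|) ^ (2 / s) * |F z|` is largest, `|F|` is at most `4 ^ (1 / s) * |F z₀|` on the disk of
radius `(1 - |z₀|) / 2` around `z₀`. There `|F| ≤ |F| ^ s * (4 ^ (1 / s) * |F z₀|) ^ (1 - s)`, and
the area mean value inequality applies. -/
theorem exists_enorm_rpow_le_of_le_one {s : ℝ} (hs : 0 < s) (hs1 : s ≤ 1) :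
    ∃ C : ℝ≥0∞, C ≠ ∞ ∧ ∀ F : ℂ → ℂ, Differentiable ℂ F →
      ‖F 0‖ₑ ^ s ≤ C * ∫⁻ ζ in ball (0 : ℂ) 1, ‖F ζ‖ₑ ^ s := by
  have hpi : ENNReal.ofReal Real.pi ≠ 0 := by simp [Real.pi_pos]
  set c : ℝ≥0∞ := ENNReal.ofReal ((2 : ℝ) ^ (2 / s)) with hc
  refine ⟨4 * ((ENNReal.ofReal Real.pi)⁻¹ * c ^ (1 - s)), ?_, fun F hF => ?_⟩
  · refine ENNReal.mul_ne_top (by simp) (ENNReal.mul_ne_top (by simpa using Real.pi_pos) ?_)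
    exact ENNReal.rpow_ne_top_of_nonneg (by linarith) ENNReal.ofReal_ne_top
  by_cases hF0 : F 0 = 0
  · simp [hF0, hs]
  obtain ⟨z₀, hz₀, hmax⟩ := (isCompact_closedBall (0 : ℂ) 1).exists_isMaxOn
    (nonempty_closedBall.2 zero_le_one)
    (f := fun z => (1 - ‖z‖) ^ (2 / s) * ‖F z‖)
    (by
      refine ContinuousOn.mul (ContinuousOn.rpow_const (by fun_prop) fun z hz => Or.inr ?_)
        hF.continuous.norm.continuousOn
      positivity)
  have h0 : ‖F 0‖ ≤ (1 - ‖z₀‖) ^ (2 / s) * ‖F z₀‖ := by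
    simpa using hmax (mem_closedBall_self zero_le_one : (0 : ℂ) ∈ closedBall (0 : ℂ) 1)
  have hlt : ‖z₀‖ < 1 := by
    refine lt_of_le_of_ne (by simpa using hz₀) fun h => ?_
    rw [h, sub_self, Real.zero_rpow (by positivity), zero_mul] at h0
    exact hF0 (norm_le_zero_iff.1 h0)
  have hFz : F z₀ ≠ 0 := by
    intro h
    rw [h, norm_zero, mul_zero] at h0
    exact hF0 (norm_le_zero_iff.1 h0)
  set r : ℝ := (1 - ‖z₀‖) / 2 with hr
  have hr0 : 0 < r := by rw [hr]; linarith
  have hrr : 1 - ‖z₀‖ = 2 * r := by rw [hr]; ring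
  have hmem : ∀ ζ ∈ ball z₀ r, r ≤ 1 - ‖ζ‖ := by
    intro ζ hζ
    rw [mem_ball, dist_eq_norm] at hζ
    have := norm_le_norm_add_norm_sub z₀ ζ
    rw [norm_sub_rev] at this
    linarith
  have hbound : ∀ ζ ∈ ball z₀ r, ‖F ζ‖ₑ ≤ c * ‖F z₀‖ₑ := by
    intro ζ hζ
    have h1 := hmem ζ hζ
    have h2 : (1 - ‖ζ‖) ^ (2 / s) * ‖F ζ‖ ≤ (1 - ‖z₀‖) ^ (2 / s) * ‖F z₀‖ :=
      hmax (show ζ ∈ closedBall (0 : ℂ) 1 by rw [mem_closedBall_zero_iff]; linarith)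
    have h3 : r ^ (2 / s) * ‖F ζ‖ ≤ r ^ (2 / s) * (2 ^ (2 / s) * ‖F z₀‖) := by
      calc r ^ (2 / s) * ‖F ζ‖ ≤ (1 - ‖ζ‖) ^ (2 / s) * ‖F ζ‖ := by gcongr
        _ ≤ _ := h2
        _ = _ := by rw [hrr, Real.mul_rpow (by norm_num) hr0.le]; ring
    have h4 := le_of_mul_le_mul_left h3 (by positivity)
    rw [hc, ← ofReal_norm, ← ofReal_norm, ← ENNReal.ofReal_mul (by positivity)]
    exact ENNReal.ofReal_le_ofReal h4
  have hsub : ball z₀ r ⊆ ball (0 : ℂ) 1 := fun ζ hζ => by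
    have := hmem ζ hζ
    rw [mem_ball_zero_iff]; linarith
  set I := ∫⁻ ζ in ball (0 : ℂ) 1, ‖F ζ‖ₑ ^ s with hI
  set x := ‖F z₀‖ₑ with hx
  have hx0 : x ≠ 0 := by simpa [hx] using hFz
  have hxt : x ≠ ∞ := enorm_ne_top
  have key : volume (ball z₀ r) * x ≤ (c * x) ^ (1 - s) * I := by
    refine (volume_ball_mul_enorm_le hF z₀ r).trans ?_
    calc ∫⁻ ζ in ball z₀ r, ‖F ζ‖ₑ ≤ ∫⁻ ζ in ball z₀ r, (c * x) ^ (1 - s) * ‖F ζ‖ₑ ^ s := by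
          refine setLIntegral_mono (by have := hF.continuous; fun_prop) fun ζ hζ => ?_
          calc ‖F ζ‖ₑ = ‖F ζ‖ₑ ^ (1 - s) * ‖F ζ‖ₑ ^ s := by
                rw [← ENNReal.rpow_add_of_nonneg _ _ (by linarith) hs.le]; simp
            _ ≤ _ := by
                gcongr ?_ * _
                exact ENNReal.rpow_le_rpow (hbound ζ hζ) (by linarith)
      _ = (c * x) ^ (1 - s) * ∫⁻ ζ in ball z₀ r, ‖F ζ‖ₑ ^ s :=
          lintegral_const_mul _ (by have := hF.continuous; fun_prop)
      _ ≤ _ := mul_le_mul_right (lintegral_mono_set hsub) _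
  have key2 : volume (ball z₀ r) * x ^ s ≤ c ^ (1 - s) * I := by
    have e1 : volume (ball z₀ r) * x = x ^ (1 - s) * (volume (ball z₀ r) * x ^ s) := by
      rw [mul_left_comm, ← ENNReal.rpow_add_of_nonneg _ _ (by linarith) hs.le]; simp
    have e2 : (c * x) ^ (1 - s) * I = x ^ (1 - s) * (c ^ (1 - s) * I) := by
      rw [ENNReal.mul_rpow_of_nonneg _ _ (by linarith)]; ring
    rw [e1, e2] at key
    refine (ENNReal.mul_le_mul_iff_right ?_ ?_).1 key
    · exact (ENNReal.rpow_pos (pos_iff_ne_zero.2 hx0) hxt).ne'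
    · exact ENNReal.rpow_ne_top_of_nonneg (by linarith) hxt
  have hvol : volume (ball z₀ r) = ENNReal.ofReal Real.pi * ENNReal.ofReal (r ^ 2) := by
    rw [Complex.volume_ball, ENNReal.ofReal_pow hr0.le, mul_comm]
    congr 1
    rw [ENNReal.ofReal]
    congr 1
    ext
    simp [Real.pi_pos.le]
  have hF0le : ‖F 0‖ₑ ^ s ≤ 4 * ENNReal.ofReal (r ^ 2) * x ^ s := by
    have h1 : ‖F 0‖ ^ s ≤ 4 * r ^ 2 * ‖F z₀‖ ^ s := by
      calc ‖F 0‖ ^ s ≤ ((1 - ‖z₀‖) ^ (2 / s) * ‖F z₀‖) ^ s := by gcongr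
        _ = 4 * r ^ 2 * ‖F z₀‖ ^ s := by
          rw [hrr, Real.mul_rpow (by positivity) (by positivity), ← Real.rpow_mul (by positivity),
            div_mul_cancel₀ _ hs.ne', Real.rpow_two]
          ring
    rw [hx, ← ofReal_norm, ← ofReal_norm,
      ENNReal.ofReal_rpow_of_nonneg (by positivity) hs.le,
      ENNReal.ofReal_rpow_of_nonneg (by positivity) hs.le,
      show (4 : ℝ≥0∞) = ENNReal.ofReal 4 by simp, ← ENNReal.ofReal_mul (by norm_num),
      ← ENNReal.ofReal_mul (by positivity)]
    exact ENNReal.ofReal_le_ofReal h1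
  have hpit : ENNReal.ofReal Real.pi ≠ ∞ := ENNReal.ofReal_ne_top
  calc ‖F 0‖ₑ ^ s ≤ 4 * ENNReal.ofReal (r ^ 2) * x ^ s := hF0le
    _ = 4 * ((ENNReal.ofReal Real.pi)⁻¹ * (volume (ball z₀ r) * x ^ s)) := by
        rw [hvol, mul_assoc (ENNReal.ofReal Real.pi), ← mul_assoc (ENNReal.ofReal Real.pi)⁻¹,
          ENNReal.inv_mul_cancel hpi hpit, one_mul, mul_assoc]
    _ ≤ 4 * ((ENNReal.ofReal Real.pi)⁻¹ * (c ^ (1 - s) * I)) := by gcongr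
    _ = _ := by ring

/-- The mean value inequality for `|F| ^ s`, up to a constant, for every `s > 0`. An exponent
`s > 1` is reduced to one in `(0, 1]` by passing to a power of `F`. -/
theorem exists_enorm_rpow_le {s : ℝ} (hs : 0 < s) :
    ∃ C : ℝ≥0∞, C ≠ ∞ ∧ ∀ F : ℂ → ℂ, Differentiable ℂ F →
      ‖F 0‖ₑ ^ s ≤ C * ∫⁻ ζ in ball (0 : ℂ) 1, ‖F ζ‖ₑ ^ s := by
  have hn : 0 < ⌈s⌉₊ := Nat.ceil_pos.2 hs
  have hn' : (0 : ℝ) < ⌈s⌉₊ := by exact_mod_cast hn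
  obtain ⟨C, hC, h⟩ := exists_enorm_rpow_le_of_le_one (s := s / ⌈s⌉₊) (by positivity)
    ((div_le_one hn').2 (Nat.le_ceil s))
  refine ⟨C, hC, fun F hF => ?_⟩
  have hpow : ∀ z, ‖(F ^ ⌈s⌉₊) z‖ₑ ^ (s / ⌈s⌉₊) = ‖F z‖ₑ ^ s := fun z => by
    rw [Pi.pow_apply, enorm_pow, ← ENNReal.rpow_natCast, ← ENNReal.rpow_mul,
      mul_div_cancel₀ _ hn'.ne']
  simpa only [hpow] using h (F ^ ⌈s⌉₊) (hF.pow _)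

/-! ### The Fock quasi-norm -/

/-- The weighted modulus `|f z| * exp (-|z|² / 2)`, of which the Fock quasi-norm is, up to a
constant, the `L^p` quasi-norm. -/
noncomputable def fockWeighted (f : ℂ → ℂ) (z : ℂ) : ℝ≥0∞ :=
  ‖f z‖ₑ * ENNReal.ofReal (Real.exp (-(‖z‖ ^ 2 / 2)))

theorem measurable_fockWeighted {f : ℂ → ℂ} (hf : Continuous f) : Measurable (fockWeighted f) := by
  have := hf.measurable
  unfold fockWeighted
  fun_prop

theorem fockWeighted_add_le (f g : ℂ → ℂ) (z : ℂ) :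
    fockWeighted (f + g) z ≤ fockWeighted f z + fockWeighted g z := by
  simp only [fockWeighted, ← add_mul]
  gcongr
  exact enorm_add_le _ _

theorem fockNorm_top (f : ℂ → ℂ) : fockNorm ∞ f = ⨆ z, fockWeighted f z := by
  simp [fockNorm, fockWeighted]

theorem fockNorm_of_ne_top {p : ℝ≥0∞} (hp : p ≠ ∞) (f : ℂ → ℂ) :
    fockNorm p f = (ENNReal.ofReal (p.toReal / (2 * Real.pi)) *
      ∫⁻ z, fockWeighted f z ^ p.toReal) ^ (1 / p.toReal) := by
  rw [fockNorm, if_neg hp]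
  congr 3
  ext z
  rw [fockWeighted, ENNReal.mul_rpow_of_nonneg _ _ ENNReal.toReal_nonneg,
    ENNReal.ofReal_rpow_of_nonneg (Real.exp_pos _).le ENNReal.toReal_nonneg, ← Real.exp_mul]
  congr 3
  ring

theorem fockNorm_rpow {p : ℝ≥0∞} (hp : p ≠ ∞) (hp0 : 0 < p) (f : ℂ → ℂ) :
    fockNorm p f ^ p.toReal =
      ENNReal.ofReal (p.toReal / (2 * Real.pi)) * ∫⁻ z, fockWeighted f z ^ p.toReal := by
  have hpos : 0 < p.toReal := ENNReal.toReal_pos hp0.ne' hp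
  rw [fockNorm_of_ne_top hp, ← ENNReal.rpow_mul, one_div_mul_cancel hpos.ne', ENNReal.rpow_one]

theorem fockNorm_smul {p : ℝ≥0∞} (hp0 : 0 < p) (c : ℂ) (f : ℂ → ℂ) :
    fockNorm p (c • f) = ‖c‖ₑ * fockNorm p f := by
  have hw : ∀ z, fockWeighted (c • f) z = ‖c‖ₑ * fockWeighted f z := fun z => by
    rw [fockWeighted, fockWeighted, Pi.smul_apply, enorm_smul, mul_assoc]
  rcases eq_or_ne p ∞ with rfl | hp
  · simp_rw [fockNorm_top, hw, ENNReal.mul_iSup]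
  · have hpos : 0 < p.toReal := ENNReal.toReal_pos hp0.ne' hp
    simp_rw [fockNorm_of_ne_top hp, hw, ENNReal.mul_rpow_of_nonneg _ _ hpos.le]
    rw [lintegral_const_mul' _ _ (ENNReal.rpow_ne_top_of_nonneg hpos.le enorm_ne_top),
      mul_left_comm, ENNReal.mul_rpow_of_nonneg _ _ (by positivity), ← ENNReal.rpow_mul,
      mul_one_div_cancel hpos.ne', ENNReal.rpow_one]

/-- A power of the Fock quasi-norm is subadditive: the first power if `1 ≤ p`, by Minkowski's
inequality, and the `p`-th power otherwise. -/
theorem exists_fockNorm_add_rpow_le {p : ℝ≥0∞} (hp0 : 0 < p) :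
    ∃ r : ℝ, 0 < r ∧ ∀ f g : ℂ → ℂ, Continuous f → Continuous g →
      fockNorm p (f + g) ^ r ≤ fockNorm p f ^ r + fockNorm p g ^ r := by
  rcases eq_or_ne p ∞ with rfl | hp
  · refine ⟨1, one_pos, fun f g _ _ => ?_⟩
    simp only [ENNReal.rpow_one, fockNorm_top]
    exact iSup_le fun z => (fockWeighted_add_le f g z).trans
      (add_le_add (le_iSup (fockWeighted f) z) (le_iSup (fockWeighted g) z))
  have hpos : 0 < p.toReal := ENNReal.toReal_pos hp0.ne' hp
  rcases le_total 1 p.toReal with h1 | h1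
  · refine ⟨1, one_pos, fun f g hf hg => ?_⟩
    simp only [ENNReal.rpow_one, fockNorm_of_ne_top hp,
      ENNReal.mul_rpow_of_nonneg _ _ (one_div_nonneg.2 hpos.le)]
    rw [← mul_add]
    gcongr
    refine le_trans ?_ (ENNReal.lintegral_Lp_add_le (measurable_fockWeighted hf).aemeasurable
      (measurable_fockWeighted hg).aemeasurable h1)
    gcongr with z
    exact fockWeighted_add_le f g z
  · refine ⟨p.toReal, hpos, fun f g hf hg => ?_⟩
    simp only [fockNorm_rpow hp hp0]
    rw [← mul_add, ← lintegral_add_left ((measurable_fockWeighted hf).pow_const _)]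
    gcongr with z
    exact (ENNReal.rpow_le_rpow (fockWeighted_add_le f g z) hpos.le).trans
      (ENNReal.rpow_add_le_add_rpow _ _ hpos.le h1)

/-- Point evaluations are bounded on the Fock space: the mean value inequality is applied to
`ζ ↦ f (w + ζ) * exp (-(conj w * ζ) - |w|² / 2)`, whose modulus is
`|f (w + ζ)| * exp (-|w + ζ|² / 2)` up to the factor `exp (|ζ|² / 2)`. -/
theorem exists_fockWeighted_le {p : ℝ≥0∞} (hp0 : 0 < p) :
    ∃ C : ℝ≥0∞, C ≠ ∞ ∧ ∀ f : ℂ → ℂ, Differentiable ℂ f →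
      ∀ w, fockWeighted f w ≤ C * fockNorm p f := by
  rcases eq_or_ne p ∞ with rfl | hp
  · refine ⟨1, by simp, fun f _ w => ?_⟩
    rw [one_mul, fockNorm_top]
    exact le_iSup (fockWeighted f) w
  have hpos : 0 < p.toReal := ENNReal.toReal_pos hp0.ne' hp
  obtain ⟨C, hC, h⟩ := exists_enorm_rpow_le hpos
  set s := p.toReal with hs
  set k : ℝ≥0∞ := ENNReal.ofReal (s / (2 * Real.pi)) with hk
  have hk0 : k ≠ 0 := by
    rw [hk, Ne, ENNReal.ofReal_eq_zero, not_le]; positivity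
  set e : ℝ≥0∞ := ENNReal.ofReal (Real.exp (1 / 2)) with he
  refine ⟨(C * (e ^ s * k⁻¹)) ^ (1 / s), ?_, fun f hf w => ?_⟩
  · refine ENNReal.rpow_ne_top_of_nonneg (by positivity) (ENNReal.mul_ne_top hC
      (ENNReal.mul_ne_top (ENNReal.rpow_ne_top_of_nonneg hpos.le ENNReal.ofReal_ne_top) ?_))
    simpa using hk0
  set F : ℂ → ℂ := fun ζ => f (w + ζ) * Complex.exp (-(starRingEnd ℂ w * ζ) - (‖w‖ ^ 2 / 2 : ℝ))
    with hF
  have hFd : Differentiable ℂ F := by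
    have := hf
    fun_prop
  have hFn : ∀ ζ, ‖F ζ‖ₑ = fockWeighted f (w + ζ) * ENNReal.ofReal (Real.exp (‖ζ‖ ^ 2 / 2)) := by
    intro ζ
    rw [hF, fockWeighted, enorm_mul, mul_assoc, ← ENNReal.ofReal_mul (Real.exp_pos _).le,
      ← Real.exp_add, ← ofReal_norm (Complex.exp _), Complex.norm_exp]
    congr 3
    simp only [Complex.sq_norm, Complex.normSq_apply, Complex.sub_re, Complex.neg_re,
      Complex.mul_re, Complex.conj_re, Complex.conj_im, Complex.ofReal_re, Complex.add_re,
      Complex.add_im]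
    ring
  have hF1 : ∀ ζ ∈ ball (0 : ℂ) 1, ‖F ζ‖ₑ ^ s ≤ e ^ s * fockWeighted f (w + ζ) ^ s := by
    intro ζ hζ
    rw [hFn, ← ENNReal.mul_rpow_of_nonneg _ _ hpos.le, mul_comm]
    refine ENNReal.rpow_le_rpow ?_ hpos.le
    gcongr ?_ * _
    refine ENNReal.ofReal_le_ofReal (Real.exp_le_exp.2 ?_)
    have h1 : ‖ζ‖ < 1 := by simpa using hζ
    have h2 := norm_nonneg ζ
    nlinarith
  have h0 : fockWeighted f w = ‖F 0‖ₑ := by simp [hFn]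
  have hmeas : Measurable fun ζ => fockWeighted f (w + ζ) :=
    (measurable_fockWeighted hf.continuous).comp (measurable_const_add w)
  have key : fockWeighted f w ^ s ≤ C * (e ^ s * k⁻¹) * fockNorm p f ^ s := by
    calc fockWeighted f w ^ s ≤ C * ∫⁻ ζ in ball (0 : ℂ) 1, ‖F ζ‖ₑ ^ s := h0 ▸ h F hFd
      _ ≤ C * ∫⁻ ζ in ball (0 : ℂ) 1, e ^ s * fockWeighted f (w + ζ) ^ s :=
          mul_le_mul_right (setLIntegral_mono ((hmeas.pow_const _).const_mul _) hF1) _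
      _ ≤ C * ∫⁻ ζ, e ^ s * fockWeighted f (w + ζ) ^ s :=
          mul_le_mul_right (setLIntegral_le_lintegral _ _) _
      _ = C * (e ^ s * ∫⁻ ζ, fockWeighted f ζ ^ s) := by
          rw [lintegral_const_mul _ (hmeas.pow_const _),
            lintegral_add_left_eq_self (fun ζ => fockWeighted f ζ ^ s)]
      _ = C * (e ^ s * (k⁻¹ * k * ∫⁻ ζ, fockWeighted f ζ ^ s)) := by
          rw [ENNReal.inv_mul_cancel hk0 ENNReal.ofReal_ne_top, one_mul]
      _ = _ := by rw [fockNorm_rpow hp hp0]; ring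
  have := ENNReal.rpow_le_rpow key (z := 1 / s) (by positivity)
  rwa [ENNReal.mul_rpow_of_nonneg _ _ (by positivity), ← ENNReal.rpow_mul, ← ENNReal.rpow_mul,
    mul_one_div_cancel hpos.ne', ENNReal.rpow_one, ENNReal.rpow_one] at this

/-! ### Pointwise estimates -/

theorem FockSpace.differentiable {p : ℝ≥0∞} (f : FockSpace p) : Differentiable ℂ f := f.2.1

theorem FockSpace.fockNorm_lt_top {p : ℝ≥0∞} (f : FockSpace p) : fockNorm p f < ∞ := f.2.2

/-- The pointwise estimate in terms of real numbers. -/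
theorem exists_norm_le_fockNorm {p : ℝ≥0∞} (hp0 : 0 < p) :
    ∃ C : ℝ, 0 ≤ C ∧ ∀ f : FockSpace p, ∀ w,
      ‖f w‖ ≤ C * (fockNorm p f).toReal * Real.exp (‖w‖ ^ 2 / 2) := by
  obtain ⟨C, hC, h⟩ := exists_fockWeighted_le hp0
  refine ⟨C.toReal, ENNReal.toReal_nonneg, fun f w => ?_⟩
  have h1 := ENNReal.toReal_mono (ENNReal.mul_ne_top hC f.fockNorm_lt_top.ne)
    (h f f.differentiable w)
  rw [fockWeighted, ENNReal.toReal_mul, ENNReal.toReal_mul, toReal_enorm,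
    ENNReal.toReal_ofReal (Real.exp_pos _).le, Real.exp_neg, ← div_eq_mul_inv] at h1
  exact (div_le_iff₀ (Real.exp_pos _)).1 h1

/-- The estimate for derivatives, from Cauchy's estimate on the circle of radius `1 / (1 + |w|)`
around `w`: on it the weight `exp (|z|² / 2)` is at most `exp 2 * exp (|w|² / 2)`. -/
theorem exists_norm_deriv_le_fockNorm {p : ℝ≥0∞} (hp0 : 0 < p) :
    ∃ C : ℝ, 0 ≤ C ∧ ∀ f : FockSpace p, ∀ w,
      ‖deriv f w‖ ≤ C * (1 + ‖w‖) * (fockNorm p f).toReal * Real.exp (‖w‖ ^ 2 / 2) := by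
  obtain ⟨C, hC, h⟩ := exists_norm_le_fockNorm hp0
  refine ⟨C * Real.exp 2, by positivity, fun f w => ?_⟩
  set N := (fockNorm p f).toReal with hN
  have hN0 : 0 ≤ N := ENNReal.toReal_nonneg
  have hw := norm_nonneg w
  have hr : (0 : ℝ) < 1 / (1 + ‖w‖) := by positivity
  have hsphere : ∀ z ∈ sphere w (1 / (1 + ‖w‖)),
      ‖f z‖ ≤ C * N * (Real.exp 2 * Real.exp (‖w‖ ^ 2 / 2)) := by
    intro z hz
    refine (h f z).trans ?_
    rw [← Real.exp_add]
    gcongr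
    rw [mem_sphere, dist_eq_norm] at hz
    have h1 : ‖z‖ ≤ ‖w‖ + 1 / (1 + ‖w‖) := by
      rw [← hz]; exact norm_le_norm_add_norm_sub' z w
    have h2 : ‖w‖ * (1 / (1 + ‖w‖)) ≤ 1 := by
      rw [mul_one_div, div_le_one (by positivity)]; linarith
    have h3 : 1 / (1 + ‖w‖) ≤ 1 := by
      rw [div_le_one (by positivity)]; linarith
    have h4 : ‖z‖ ^ 2 ≤ (‖w‖ + 1 / (1 + ‖w‖)) ^ 2 := by gcongr
    nlinarith
  have := Complex.norm_deriv_le_of_forall_mem_sphere_norm_le hr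
    f.differentiable.diffContOnCl hsphere
  refine this.trans (le_of_eq ?_)
  rw [div_div_eq_mul_div, div_one]
  ring

/-! ### The topology of the Fock space -/

theorem FockSpace.isOpen_iff {p : ℝ≥0∞} {U : Set (FockSpace p)} :
    IsOpen U ↔ ∀ f ∈ U, ∃ ε > 0, ∀ h : FockSpace p,
      fockNorm p (h - f : FockSpace p) < ε → h ∈ U := Iff.rfl

theorem FockSpace.fockNorm_zero {p : ℝ≥0∞} (hp0 : 0 < p) :
    fockNorm p (0 : FockSpace p) = 0 := by
  have := fockNorm_smul hp0 0 (0 : FockSpace p)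
  rw [enorm_zero, zero_mul] at this
  rw [← this]
  congr 1
  exact (zero_smul ℂ _).symm

theorem FockSpace.isOpen_fockNorm_lt {p : ℝ≥0∞} (hp0 : 0 < p) (R : ℝ≥0∞) :
    IsOpen {f : FockSpace p | fockNorm p f < R} := by
  obtain ⟨r, hr, hadd⟩ := exists_fockNorm_add_rpow_le hp0
  refine FockSpace.isOpen_iff.2 fun f hf => ?_
  have hf' : fockNorm p f ^ r < R ^ r := ENNReal.rpow_lt_rpow hf hr
  refine ⟨(R ^ r - fockNorm p f ^ r) ^ (1 / r), ?_, fun h hh => ?_⟩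
  · exact ENNReal.rpow_pos_of_nonneg (tsub_pos_of_lt hf') (by positivity)
  have h1 : fockNorm p (h - f : FockSpace p) ^ r < R ^ r - fockNorm p f ^ r := by
    have := ENNReal.rpow_lt_rpow hh hr
    rwa [← ENNReal.rpow_mul, one_div_mul_cancel hr.ne', ENNReal.rpow_one] at this
  have h2 := hadd (h - f : FockSpace p) f (h - f).differentiable.continuous
    f.differentiable.continuous
  have h3 : ((h - f : FockSpace p) : ℂ → ℂ) + f = h := by
    change ((h : ℂ → ℂ) - f) + f = h
    exact sub_add_cancel _ _
  rw [h3] at h2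
  have h4 : fockNorm p h ^ r < R ^ r := h2.trans_lt (lt_tsub_iff_right.1 h1)
  exact (ENNReal.rpow_lt_rpow_iff hr).1 h4

theorem FockSpace.continuous_eval {p : ℝ≥0∞} (hp0 : 0 < p) (z : ℂ) :
    Continuous fun f : FockSpace p => f z := by
  obtain ⟨C, hC, hb⟩ := exists_norm_le_fockNorm hp0
  refine continuous_def.2 fun U hU => FockSpace.isOpen_iff.2 fun f hf => ?_
  obtain ⟨ε, hε, hball⟩ := Metric.isOpen_iff.1 hU (f z) hf
  set D := C * Real.exp (‖z‖ ^ 2 / 2) + 1 with hD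
  have hD0 : 0 < D := by positivity
  refine ⟨ENNReal.ofReal (ε / D), by simpa using div_pos hε hD0, fun h hh => hball ?_⟩
  have h1 : (fockNorm p (h - f : FockSpace p)).toReal < ε / D :=
    (ENNReal.lt_ofReal_iff_toReal_lt (h - f).fockNorm_lt_top.ne).1 hh
  rw [mem_ball, dist_eq_norm]
  set N := (fockNorm p (h - f : FockSpace p)).toReal with hN
  have hN0 : 0 ≤ N := ENNReal.toReal_nonneg
  calc ‖h z - f z‖ = ‖(h - f : FockSpace p) z‖ := rfl
    _ ≤ C * N * Real.exp (‖z‖ ^ 2 / 2) := hb _ z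
    _ ≤ N * D := by rw [hD]; linarith
    _ < ε := (lt_div_iff₀ hD0).1 h1

/-! ### Compact operators between Fock spaces -/

/-- A compact operator maps a multiple of each ball around `0` into a compact set. -/
theorem exists_smul_mem_of_isCompactOperator {p q : ℝ≥0∞} (hp0 : 0 < p)
    {T : FockSpace p →ₗ[ℂ] FockSpace q} (hT : IsCompactOperator T) {B : ℝ≥0∞} (hB : B ≠ ∞) :
    ∃ c : ℂ, c ≠ 0 ∧ ∃ K : Set (FockSpace q), IsCompact K ∧
      ∀ f : FockSpace p, fockNorm p f ≤ B → c • T f ∈ K := by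
  obtain ⟨K, hK, hmem⟩ := hT
  obtain ⟨U, hUK, hU, h0⟩ := mem_nhds_iff.1 hmem
  obtain ⟨ε, hε, hball⟩ := FockSpace.isOpen_iff.1 hU 0 h0
  obtain ⟨c, hc, hcB⟩ := ENNReal.exists_nnreal_pos_mul_lt hB hε.ne'
  refine ⟨((c : ℝ) : ℂ), by simpa using hc.ne', K, hK, fun f hf => ?_⟩
  rw [← map_smul]
  refine hUK (hball _ ?_)
  rw [sub_zero]
  refine lt_of_le_of_lt (le_of_eq (fockNorm_smul hp0 _ f)) (lt_of_le_of_lt ?_ hcB)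
  gcongr
  simp [← ofReal_norm]

/-- A compact operator between Fock spaces is bounded: a compact set is covered by the increasing
open sets `{f | ‖f‖ < n}`, hence lies in one of them. -/
theorem fockOpNorm_lt_top_of_isCompactOperator {p q : ℝ≥0∞} (hp0 : 0 < p) (hq0 : 0 < q)
    {T : FockSpace p →ₗ[ℂ] FockSpace q} (hT : IsCompactOperator T) : fockOpNorm T < ∞ := by
  obtain ⟨c, hc, K, hK, hcK⟩ := exists_smul_mem_of_isCompactOperator hp0 hT ENNReal.one_ne_top
  obtain ⟨n, hn⟩ := hK.elim_directed_cover (fun n : ℕ => {f : FockSpace q | fockNorm q f < n})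
    (fun n => FockSpace.isOpen_fockNorm_lt hq0 n)
    (fun f _ => Set.mem_iUnion.2 (ENNReal.exists_nat_gt f.fockNorm_lt_top.ne))
    (directed_of_isDirected_le fun m n hmn f (hf : fockNorm q f < m) =>
      hf.trans_le (by exact_mod_cast hmn : (m : ℝ≥0∞) ≤ n))
  have hc0 : ‖c‖ₑ ≠ 0 := by simpa using hc
  refine lt_of_le_of_lt (iSup₂_le fun f hf => ?_)
    (ENNReal.mul_lt_top (ENNReal.inv_lt_top.2 (pos_iff_ne_zero.2 hc0))
      (ENNReal.natCast_lt_top n) : ‖c‖ₑ⁻¹ * n < ∞)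
  have h1 : fockNorm q (c • T f : FockSpace q) < n := hn (hcK f hf)
  have h2 : fockNorm q (c • T f : FockSpace q) = ‖c‖ₑ * fockNorm q (T f) := fockNorm_smul hq0 c _
  calc fockNorm q (T f) = ‖c‖ₑ⁻¹ * (‖c‖ₑ * fockNorm q (T f)) := by
        rw [← mul_assoc, ENNReal.inv_mul_cancel hc0 enorm_ne_top, one_mul]
    _ ≤ _ := by rw [← h2]; gcongr

/-- A compact operator maps a bounded family whose images tend to `0` pointwise to a family that
tends to `0` in norm, since each cluster point of the images is `0`. -/
theorem tendsto_fockNorm_of_isCompactOperator {p q : ℝ≥0∞} (hp0 : 0 < p) (hq0 : 0 < q)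
    {T : FockSpace p →ₗ[ℂ] FockSpace q} (hT : IsCompactOperator T) {ι : Type*} {l : Filter ι}
    {u : ι → FockSpace p} {B : ℝ≥0∞} (hB : B ≠ ∞) (hu : ∀ i, fockNorm p (u i) ≤ B)
    (hlim : ∀ z, Tendsto (fun i => T (u i) z) l (𝓝 0)) :
    Tendsto (fun i => fockNorm q (T (u i))) l (𝓝 0) := by
  obtain ⟨c, hc, K, hK, hcK⟩ := exists_smul_mem_of_isCompactOperator hp0 hT hB
  have hc0 : ‖c‖ₑ ≠ 0 := by simpa using hc
  have hsmul : ∀ i, fockNorm q (c • T (u i) : FockSpace q) = ‖c‖ₑ * fockNorm q (T (u i)) :=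
    fun i => fockNorm_smul hq0 c _
  refine ENNReal.tendsto_nhds_zero.2 fun ε hε => ?_
  by_contra hnot
  have hfreq : ∃ᶠ i in l, ε < fockNorm q (T (u i)) := by
    simpa [Filter.not_eventually] using hnot
  set l' := l ⊓ 𝓟 {i | ε < fockNorm q (T (u i))} with hl'
  have : l'.NeBot := frequently_mem_iff_neBot.1 hfreq
  obtain ⟨h, -, hcl⟩ := hK.exists_clusterPt (f := map (fun i => c • T (u i)) l')
    (le_principal_iff.2 (mem_map.2 (univ_mem' fun i => hcK _ (hu i))))
  have hzero : h = 0 := by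
    refine Subtype.ext (funext fun z => ?_)
    have h1 : MapClusterPt (h z) l' (fun i => (c • T (u i) : FockSpace q) z) :=
      MapClusterPt.continuousAt_comp (FockSpace.continuous_eval hq0 z).continuousAt hcl
    have h2 : Tendsto (fun i => (c • T (u i) : FockSpace q) z) l' (𝓝 0) := by
      have := ((hlim z).const_mul c).mono_left (inf_le_left : l' ≤ l)
      rwa [mul_zero] at this
    exact eq_of_nhds_neBot (h1.neBot.mono (inf_le_inf_left _ h2))
  have hopen := (FockSpace.isOpen_fockNorm_lt hq0 (‖c‖ₑ * ε)).mem_nhds (x := h) (by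
    rw [hzero, Set.mem_ofPred_eq, FockSpace.fockNorm_zero hq0]
    exact ENNReal.mul_pos hc0 hε.ne')
  have hfr : ∃ᶠ i in l', fockNorm q (c • T (u i) : FockSpace q) < ‖c‖ₑ * ε :=
    (mapClusterPt_iff_frequently.1 hcl) _ hopen
  have hev : ∀ᶠ i in l', ε < fockNorm q (T (u i)) := mem_inf_of_right (mem_principal_self _)
  obtain ⟨i, hi1, hi2⟩ := (hfr.and_eventually hev).exists
  rw [hsmul] at hi1
  exact absurd hi1 (not_lt.2 (by gcongr))

/-! ### Normalized reproducing kernels -/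

/-- The normalized reproducing kernel `z ↦ exp (conj w * z - |w|² / 2)` of the Fock space at `w`. -/
noncomputable def fockKernel (w z : ℂ) : ℂ :=
  Complex.exp (starRingEnd ℂ w * z - (‖w‖ ^ 2 / 2 : ℝ))

theorem differentiable_fockKernel (w : ℂ) : Differentiable ℂ (fockKernel w) := by
  unfold fockKernel
  fun_prop

theorem fockKernel_self (w : ℂ) : fockKernel w w = (Real.exp (‖w‖ ^ 2 / 2) : ℝ) := by
  rw [fockKernel, mul_comm, Complex.mul_conj, Complex.normSq_eq_norm_sq, ← Complex.ofReal_sub,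
    ← Complex.ofReal_exp]
  congr 2
  ring

theorem norm_fockKernel_le (w z : ℂ) :
    ‖fockKernel w z‖ ≤ Real.exp (‖w‖ * ‖z‖ - ‖w‖ ^ 2 / 2) := by
  rw [fockKernel, Complex.norm_exp, Complex.sub_re, Complex.ofReal_re]
  gcongr
  refine (Complex.re_le_norm _).trans (le_of_eq ?_)
  rw [norm_mul, RCLike.norm_conj]

theorem fockWeighted_fockKernel (w z : ℂ) :
    fockWeighted (fockKernel w) z = ENNReal.ofReal (Real.exp (-(‖-w + z‖ ^ 2 / 2))) := by
  rw [fockWeighted, fockKernel, ← ofReal_norm, ← ENNReal.ofReal_mul (norm_nonneg _),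
    Complex.norm_exp, ← Real.exp_add]
  congr 2
  simp only [Complex.sq_norm, Complex.normSq_apply, Complex.sub_re, Complex.neg_re,
    Complex.mul_re, Complex.conj_re, Complex.conj_im, Complex.ofReal_re, Complex.add_re,
    Complex.add_im, Complex.neg_im]
  ring

/-- The Fock norms of the kernels are bounded, uniformly in `w`: their weighted moduli are the
translates of one Gaussian. -/
theorem exists_fockNorm_fockKernel_le {p : ℝ≥0∞} (hp0 : 0 < p) :
    ∃ B : ℝ≥0∞, B ≠ ∞ ∧ ∀ w, fockNorm p (fockKernel w) ≤ B := by
  rcases eq_or_ne p ∞ with rfl | hp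
  · refine ⟨1, ENNReal.one_ne_top, fun w => ?_⟩
    rw [fockNorm_top]
    refine iSup_le fun z => ?_
    rw [fockWeighted_fockKernel, ENNReal.ofReal_le_one, Real.exp_le_one_iff]
    exact neg_nonpos.2 (by positivity)
  have hpos : 0 < p.toReal := ENNReal.toReal_pos hp0.ne' hp
  set G : ℂ → ℝ≥0∞ := fun z => ENNReal.ofReal (Real.exp (-(‖z‖ ^ 2 / 2))) ^ p.toReal with hG
  have hfin : ∫⁻ z, G z < ∞ := by
    have h1 := (GaussianFourier.integrable_cexp_neg_mul_sq_norm_add (V := ℂ)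
      (b := ((p.toReal / 2 : ℝ) : ℂ)) (by simpa using hpos) 0 0).2
    refine lt_of_le_of_lt (lintegral_mono fun z => le_of_eq ?_) h1
    simp only [hG]
    rw [← ofReal_norm, Complex.norm_exp, ENNReal.ofReal_rpow_of_nonneg (Real.exp_pos _).le
      hpos.le, ← Real.exp_mul, zero_mul, add_zero, ← Complex.ofReal_pow, ← Complex.ofReal_neg,
      ← Complex.ofReal_mul, Complex.ofReal_re]
    congr 2
    ring
  refine ⟨(ENNReal.ofReal (p.toReal / (2 * Real.pi)) * ∫⁻ z, G z) ^ (1 / p.toReal),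
    ENNReal.rpow_ne_top_of_nonneg (by positivity)
      (ENNReal.mul_ne_top ENNReal.ofReal_ne_top hfin.ne), fun w => le_of_eq ?_⟩
  rw [fockNorm_of_ne_top hp, ← lintegral_add_left_eq_self G (-w)]
  simp only [fockWeighted_fockKernel, hG]

/-! ### Volterra-type integral operators -/

theorem hasDerivAt_volterra {g f : ℂ → ℂ} (hg : Differentiable ℂ g) (hf : Differentiable ℂ f)
    (z : ℂ) : HasDerivAt (volterra g f) (f z * deriv g z) z := by
  have hg' : Differentiable ℂ (deriv g) := hg.deriv
  obtain ⟨H, hH⟩ := (hf.mul hg').isExactOn_univ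
  have hH' : ∀ z, HasDerivAt H (f z * deriv g z) z := fun z => hH z (Set.mem_univ z)
  have hV : volterra g f = fun z => H z - H 0 := by
    ext z
    have hcont : Continuous fun t : ℝ => z * (f (t * z) * deriv g (t * z)) := by
      have := hf.continuous
      have := hg'.continuous
      fun_prop
    have h1 : ∀ t ∈ Set.uIcc (0 : ℝ) 1,
        HasDerivAt (fun t : ℝ => H (t * z)) (z * (f (t * z) * deriv g (t * z))) t := by
      intro t _
      have h2 : HasDerivAt (fun t : ℝ => (t : ℂ) * z) z t := by
        simpa using (Complex.ofRealCLM.hasDerivAt (x := t)).mul_const z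
      rw [mul_comm z]
      exact (hH' (t * z)).comp t h2
    have := intervalIntegral.integral_eq_sub_of_hasDerivAt h1 (hcont.intervalIntegrable _ _)
    rw [intervalIntegral.integral_const_mul] at this
    simpa [volterra] using this
  rw [hV]
  exact (hH' z).sub_const _

theorem tendsto_volterra_fockKernel {g : ℂ → ℂ} (hg : Differentiable ℂ g) (z : ℂ) :
    Tendsto (fun w => volterra g (fockKernel w) z) (Bornology.cobounded ℂ) (𝓝 0) := by
  obtain ⟨G, hG⟩ := (isCompact_closedBall (0 : ℂ) ‖z‖).exists_bound_of_continuousOn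
    hg.deriv.continuous.continuousOn
  have hG0 : 0 ≤ G := (norm_nonneg _).trans (hG 0 (mem_closedBall_self (norm_nonneg _)))
  have hb : ∀ w, ‖volterra g (fockKernel w) z‖ ≤
      ‖z‖ * G * Real.exp (‖w‖ * (‖z‖ - ‖w‖ / 2)) := by
    intro w
    have h1 : ‖∫ t in (0 : ℝ)..1, fockKernel w (t * z) * deriv g (t * z)‖ ≤
        Real.exp (‖w‖ * (‖z‖ - ‖w‖ / 2)) * G * |(1 : ℝ) - 0| := by
      refine intervalIntegral.norm_integral_le_of_norm_le_const fun t ht => ?_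
      rw [Set.uIoc_of_le zero_le_one] at ht
      have h2 : ‖(t : ℂ) * z‖ ≤ ‖z‖ := by
        rw [norm_mul, Complex.norm_real, Real.norm_of_nonneg ht.1.le]
        exact mul_le_of_le_one_left (norm_nonneg _) ht.2
      rw [norm_mul]
      gcongr
      · refine (norm_fockKernel_le _ _).trans (Real.exp_le_exp.2 ?_)
        have := mul_le_mul_of_nonneg_left h2 (norm_nonneg w)
        nlinarith
      · exact hG _ (by simpa using h2)
    rw [volterra, norm_mul]
    calc _ ≤ ‖z‖ * (Real.exp (‖w‖ * (‖z‖ - ‖w‖ / 2)) * G * |(1 : ℝ) - 0|) := by gcongr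
      _ = _ := by simp; ring
  refine squeeze_zero_norm hb ?_
  rw [← mul_zero (‖z‖ * G)]
  refine Tendsto.const_mul _ (Real.tendsto_exp_atBot.comp ?_)
  have hn : Tendsto (fun w : ℂ => ‖w‖) (Bornology.cobounded ℂ) atTop :=
    tendsto_norm_cobounded_atTop
  refine hn.atTop_mul_atBot₀ ?_
  exact tendsto_atBot_add_const_left _ _ (tendsto_neg_atTop_atBot.comp (hn.atTop_div_const two_pos))

/-- If `|h z| = o(|z|)` as `z → ∞`, then the entire function `h` is constant. -/
theorem eq_of_tendsto_norm_div {h : ℂ → ℂ} (hh : Differentiable ℂ h)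
    (hlim : Tendsto (fun z => ‖h z‖ / (1 + ‖z‖)) (Bornology.cobounded ℂ) (𝓝 0)) (z w : ℂ) :
    h z = h w := by
  refine is_const_of_deriv_eq_zero hh (fun c => ?_) z w
  refine norm_le_zero_iff.1 (le_of_forall_pos_le_add fun ε hε => ?_)
  have hev := hlim.eventually (gt_mem_nhds (show (0 : ℝ) < ε / 2 by positivity))
  obtain ⟨R, -, hR⟩ := (hasBasis_cobounded_norm (E := ℂ)).eventually_iff.1 hev
  -- On the circle of this radius around `c`, `|z| ≥ R` and `1 + |z| ≤ 2 * S`.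
  set S := |R| + ‖c‖ + 1 with hS
  have hS0 : 0 < S := by positivity
  have hsph : ∀ ζ ∈ sphere c S, ‖h ζ‖ ≤ ε * S := by
    intro ζ hζ
    rw [mem_sphere, dist_eq_norm] at hζ
    have h1 : S - ‖c‖ ≤ ‖ζ‖ := by
      have := norm_sub_le ζ c; linarith
    have h2 : ‖ζ‖ ≤ ‖c‖ + S := by
      have := norm_le_norm_add_norm_sub' ζ c; linarith
    have h3 : R ≤ ‖ζ‖ := by have := le_abs_self R; linarith
    have h4 := (div_lt_iff₀ (by positivity)).1 (hR h3)
    have h5 : 1 + ‖ζ‖ ≤ 2 * S := by have := abs_nonneg R; linarith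
    nlinarith
  have := Complex.norm_deriv_le_of_forall_mem_sphere_norm_le hS0 hh.diffContOnCl hsph
  rwa [mul_div_cancel_right₀ _ hS0.ne', ← zero_add ε] at this

/-- The symbol of a compact Volterra-type operator is affine. For the kernels `k_w`,
`(V_g k_w)' w = k_w w * g' w = exp (|w|² / 2) * g' w`, so that `|g' w|` is at most a constant times
`(1 + |w|) * ‖V_g k_w‖`, and compactness makes `‖V_g k_w‖` tend to `0`. -/
theorem exists_affine_of_isCompactOperator {p q : ℝ≥0∞} (hp0 : 0 < p) (hq0 : 0 < q) {g : ℂ → ℂ}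
    (hg : Differentiable ℂ g) {T : FockSpace p →ₗ[ℂ] FockSpace q} (hT : IsVolterraOp g T)
    (hc : IsCompactOperator T) : ∃ a b : ℂ, ∀ z, g z = a * z + b := by
  obtain ⟨B, hB, hkB⟩ := exists_fockNorm_fockKernel_le hp0
  let k : ℂ → FockSpace p := fun w =>
    ⟨fockKernel w, differentiable_fockKernel w, (hkB w).trans_lt hB.lt_top⟩
  have hTk : ∀ w, (T (k w) : ℂ → ℂ) = volterra g (fockKernel w) := fun w => funext (hT (k w))
  have hlim : Tendsto (fun w => (fockNorm q (T (k w))).toReal) (Bornology.cobounded ℂ) (𝓝 0) := by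
    refine (ENNReal.tendsto_toReal ENNReal.zero_ne_top).comp
      (tendsto_fockNorm_of_isCompactOperator hp0 hq0 hc hB hkB fun z => ?_)
    simp only [hTk]
    exact tendsto_volterra_fockKernel hg z
  obtain ⟨C, hC, hder⟩ := exists_norm_deriv_le_fockNorm hq0
  have hbound : ∀ w, ‖deriv g w‖ / (1 + ‖w‖) ≤ C * (fockNorm q (T (k w))).toReal := by
    intro w
    have h1 := hder (T (k w)) w
    rw [hTk, (hasDerivAt_volterra hg (differentiable_fockKernel w) w).deriv, fockKernel_self,
      norm_mul, Complex.norm_real, Real.norm_of_nonneg (Real.exp_pos _).le, mul_comm,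
      ← hTk] at h1
    rw [div_le_iff₀ (by positivity)]
    refine (le_of_mul_le_mul_right h1 (Real.exp_pos _)).trans (le_of_eq (by ring))
  have hconst : ∀ z, deriv g z = deriv g 0 := fun z =>
    eq_of_tendsto_norm_div hg.deriv (squeeze_zero (fun w => by positivity) hbound
      (by simpa using hlim.const_mul C)) z 0
  refine ⟨deriv g 0, g 0, fun z => ?_⟩
  have hd : Differentiable ℂ fun z => g z - deriv g 0 * z := by fun_prop
  have := is_const_of_deriv_eq_zero hd (fun z => by
    have h1 := (hg z).hasDerivAt.sub ((hasDerivAt_id z).const_mul (deriv g 0))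
    have h2 := h1.deriv
    rw [hconst z, mul_one, sub_self] at h2
    exact h2) z 0
  simp only [mul_zero, sub_zero] at this
  rw [← this]; ring

/-! ### The path of dilated symbols -/

theorem fockOpNorm_smul {p q : ℝ≥0∞} (hq0 : 0 < q) (c : ℂ)
    (T : FockSpace p →ₗ[ℂ] FockSpace q) : fockOpNorm (c • T) = ‖c‖ₑ * fockOpNorm T := by
  simp only [fockOpNorm, ENNReal.mul_iSup]
  exact iSup_congr fun f => iSup_congr fun _ => fockNorm_smul hq0 c (T f)

theorem isVolterraOp_smul {p q : ℝ≥0∞} {g : ℂ → ℂ} {T : FockSpace p →ₗ[ℂ] FockSpace q}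
    (hT : IsVolterraOp g T) {a b : ℂ} (hab : ∀ z, g z = a * z + b) (t : ℂ) :
    IsVolterraOp (fun z => g (t * z)) (t • T) := by
  intro f z
  have hd : ∀ s c z : ℂ, deriv (fun z => a * (s * z) + c) z = s * a := fun s c z => by
    have := (((hasDerivAt_id z).const_mul s).const_mul a).add_const c
    rw [mul_one, mul_comm a] at this
    exact this.deriv
  have hg : deriv g = fun _ => a := by
    have : g = fun z => a * (1 * z) + b := funext fun z => by rw [hab, one_mul]
    ext z
    rw [this, hd, one_mul]
  have h1 : (t • T) f z = t * T f z := rfl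
  rw [h1, hT f z]
  simp only [volterra, hg]
  simp only [hab, hd, intervalIntegral.integral_mul_const]
  ring

/-- If `V_g : F_p → F_q` is compact, then `V_g` and `V_{g(0)} = 0` have the same path component in
`V(F_p, F_q)`; moreover `g` is affine and `t ↦ V_{g(t z)}` is a path from `V_{g(0)}` to `V_g`. -/
theorem theorem1 (p q : ℝ≥0∞) (hp : 0 < p) (hq : 0 < q)
    (g : ℂ → ℂ) (hg : Differentiable ℂ g)
    (T : FockSpace p →ₗ[ℂ] FockSpace q) (hT : IsVolterraOp g T) (hc : IsCompactOperator T) :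
    ∃ Vg V0 : VolterraSpace p q,
      Vg.op = T ∧ IsVolterraOp (fun _ => g 0) V0.op ∧ V0.op = 0 ∧
      pathComponent Vg = pathComponent V0 ∧
      (∃ a b : ℂ, ∀ z : ℂ, g z = a * z + b) ∧
      ∃ γ : Path V0 Vg, ∀ t : unitInterval,
        IsVolterraOp (fun z : ℂ => g (((t : ℝ) : ℂ) * z)) (γ t).op := by
  obtain ⟨a, b, hab⟩ := exists_affine_of_isCompactOperator hp hq hg hT hc
  have hTb := fockOpNorm_lt_top_of_isCompactOperator hp hq hc
  -- Since `g` is affine, the operator with symbol `g (t * z)` is `t • T`.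
  let V : ℂ → VolterraSpace p q := fun t =>
    { op := t • T
      bounded := by
        rw [fockOpNorm_smul hq]
        exact ENNReal.mul_lt_top enorm_lt_top hTb
      exists_symbol := ⟨fun z => g (t * z), by fun_prop, isVolterraOp_smul hT hab t⟩ }
  have hV : Continuous V := by
    refine continuous_def.2 fun U hU => Metric.isOpen_iff.2 fun t ht => ?_
    obtain ⟨ε, hε, hball⟩ := hU (V t) ht
    obtain ⟨δ, hδ, hδε⟩ := ENNReal.exists_nnreal_pos_mul_lt hTb.ne hε.ne'
    refine ⟨δ, hδ, fun s hs => hball (V s) ?_⟩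
    have h1 : (V s).op - (V t).op = (s - t) • T := (sub_smul s t T).symm
    change fockOpNorm ((V s).op - (V t).op) < ε
    rw [h1, fockOpNorm_smul hq]
    refine lt_of_le_of_lt ?_ hδε
    gcongr
    rw [mem_ball, dist_eq_norm] at hs
    rw [← ofReal_norm, ← ENNReal.ofReal_coe_nnreal]
    exact ENNReal.ofReal_le_ofReal hs.le
  let γ : Path (V 0) (V 1) :=
    { toFun := fun t => V ((t : ℝ) : ℂ)
      continuous_toFun := hV.comp (by fun_prop)
      source' := by simp
      target' := by simp }
  refine ⟨V 1, V 0, one_smul ℂ T, ?_, zero_smul ℂ T, pathComponent_congr ⟨γ⟩, ⟨a, b, hab⟩, γ,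
    fun t => isVolterraOp_smul hT hab _⟩
  have h0 : (fun _ : ℂ => g 0) = fun z => g (0 * z) := by simp only [zero_mul]
  rw [h0]
  exact isVolterraOp_smul hT hab 0
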